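/- Let $\mathbf A\in\mathbb R^{k\times n}$, let $\boldsymbol\lambda\in\mathbb R^k$ have non-negative entries (the dark current), let $\mathbf X$ be a random vector in $\mathbb R^n$ with $\mathbf A\mathbf X\in\mathbb R^k_+$ almost surely (for instance $\mathbf X\ge 0$ and $\mathbf A$ entrywise non-negative), and let $\mathbf Y=\mathcal P(\mathbf A\mathbf X+\boldsymbol\lambda)$, that is, $\mathbf Y$ takes values in $\mathbb Z_+^k$ and, with $0^0=1$, $$P_{\mathbf Y|\mathbf X}(\boldsymbol y|\boldsymbol x)=\prod_{i=1}^k \frac{1}{y_i!}\left([\mathbf A\boldsymbol x]_i+\lambda_i\right)^{y_i} e^{-([\mathbf A\boldsymbol x]_i+\lambda_i)} .$$ Assume that $\mathbf A\mathbf X+\boldsymbol\lambda$ is non-degenerate: no non-trivial linear combination of its coordinates is almost surely constant (when second moments are finite, this says that its covariance matrix has full rank). Let $\mathbf C\in\mathbb R^{n\times k}$ and $\mathbf b\in\mathbb R^n$, and consider the following four conditions: 1. $\boldsymbol\lambda=\mathbf 0$; 2. $\mathbf A\mathbf C$ is a diagonal matrix with $0<[\mathbf A\mathbf C]_{ii}<1$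 for all $i$; 3. $[\mathbf A\mathbf b]_i>0$ for all $i$; 4. the law of $\mathbf A\mathbf X$ is $\prod_{i=1}^k \mathsf{Gam}\left(\frac{1-[\mathbf A\mathbf C]_{ii}}{[\mathbf A\mathbf C]_{ii}},\frac{[\mathbf A\mathbf b]_i}{[\mathbf A\mathbf C]_{ii}}\right)$, where $\mathsf{Gam}(\alpha,\theta)$ is the gamma law with rate $\alpha$ and shape $\theta$, i.e. with density $\frac{\alpha^\theta}{\Gamma(\theta)}x^{\theta-1}e^{-\alpha x}$ on $x\ge 0$. If $k=n$, then $$\mathbb E[\mathbf X\mid\mathbf Y=\boldsymbol y]=\mathbf C\boldsymbol y+\mathbf b\quad\text{for all }\boldsymbol y\in\mathbb Z_+^k \tag{$*$}$$ holds if and only if all four conditions hold. For arbitrary $k$ and $n$, $(*)$ implies the four conditions, and the four conditions imply $\mathbb E[\mathbf A\mathbf X\mid\mathbf Y=\boldsymbol y]=\mathbf A(\mathbf C\boldsymbol y+\mathbf b)$ for all $\boldsymbol y\in\mathbb Z_+^k$. Here $\mathbb E[\mathbf Z\mid\mathbf Y=\boldsymbol y]=\boldsymbol z$ includes that $\mathbf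 Y=\boldsymbol y$ has positive probability and that $\mathbf Z$ is integrable on this event. -/

import Mathlib

open MeasureTheory ProbabilityTheory Matrix

noncomputable section

namespace PoissonChannel

/-- The channel law `P_{Y|X}(y|x) = ∏ᵢ ([A x]ᵢ + λᵢ)^{yᵢ} e^{-([A x]ᵢ + λᵢ)} / yᵢ!`, with `0 ^ 0 = 1`. -/
def channelPMF {k n : ℕ} (A : Matrix (Fin k) (Fin n) ℝ) (lam : Fin k → ℝ)
    (x : Fin n → ℝ) (y : Fin k → ℕ) : ℝ :=
  ∏ i, ((A *ᵥ x) i + lam i) ^ y i * Real.exp (-((A *ᵥ x) i + lam i)) / (y i).factorial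

/-- `Y = 𝒫(A X + λ)`: the conditional law of `Y` given `X = x` has probability mass function
`channelPMF A lam x`, i.e. `P(X ∈ B, Y = y) = ∫_B P_{Y|X}(y|x) dP_X(x)`. -/
def IsPoissonOutput {Ω : Type*} [MeasurableSpace Ω] (μ : Measure Ω) {k n : ℕ}
    (A : Matrix (Fin k) (Fin n) ℝ) (lam : Fin k → ℝ)
    (X : Ω → Fin n → ℝ) (Y : Ω → Fin k → ℕ) : Prop :=
  ∀ B : Set (Fin n → ℝ), MeasurableSet B → ∀ y : Fin k → ℕ,
    μ (X ⁻¹' B ∩ Y ⁻¹' {y}) = ∫⁻ x in B, ENNReal.ofReal (channelPMF A lam x y) ∂(μ.map X)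

/-- `E[Z | Y = y] = z`, for a discrete `Y`: the event `Y = y` has positive probability, `Z` is
integrable on it, and the mean of `Z` under the conditional probability given `Y = y` is `z`. -/
def HasCondMean {Ω : Type*} [MeasurableSpace Ω] (μ : Measure Ω) {k m : ℕ}
    (Z : Ω → Fin m → ℝ) (Y : Ω → Fin k → ℕ) (y : Fin k → ℕ) (z : Fin m → ℝ) : Prop :=
  0 < μ (Y ⁻¹' {y}) ∧ IntegrableOn Z (Y ⁻¹' {y}) μ ∧ ∫ ω, Z ω ∂μ[|Y ⁻¹' {y}] = z

/-- The vector of counts `y`, seen as a real vector. -/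
def toReal {k : ℕ} (y : Fin k → ℕ) : Fin k → ℝ := fun i => (y i : ℝ)

/-- A random vector is non-degenerate if no nontrivial linear combination of its coordinates is
almost surely constant. For square-integrable vectors this says that the covariance matrix has
full rank, see `nondegenerate_iff_det_covariance_ne_zero`; no second moment is needed here. -/
def Nondegenerate {Ω : Type*} [MeasurableSpace Ω] (μ : Measure Ω) {k : ℕ}
    (U : Ω → Fin k → ℝ) : Prop :=
  ∀ v : Fin k → ℝ, v ≠ 0 → ¬ ∃ a : ℝ, ∀ᵐ ω ∂μ, v ⬝ᵥ U ω = a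

theorem nondegenerate_iff_det_covariance_ne_zero {Ω : Type*} [MeasurableSpace Ω]
    (μ : Measure Ω) [IsProbabilityMeasure μ] {k : ℕ} (U : Ω → Fin k → ℝ)
    (hU : ∀ i, MemLp (fun ω => U ω i) 2 μ) :
    Nondegenerate μ U ↔
      (Matrix.of fun i j => cov[fun ω => U ω i, fun ω => U ω j; μ]).det ≠ 0 := by
  have hL : ∀ v : Fin k → ℝ, MemLp (fun ω => v ⬝ᵥ U ω) 2 μ := fun v => by
    simp only [dotProduct]
    exact memLp_finsetSum _ fun i _ => (hU i).const_mul (v i)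
  have key : ∀ (v : Fin k → ℝ) (W : Ω → ℝ), MemLp W 2 μ →
      cov[W, fun ω => v ⬝ᵥ U ω; μ] = ∑ j, cov[W, fun ω => U ω j; μ] * v j := by
    intro v W hW
    simp only [dotProduct]
    rw [covariance_fun_sum_right (fun i => (hU i).const_mul (v i)) hW]
    exact Finset.sum_congr rfl fun j _ => by rw [covariance_const_mul_right, mul_comm]
  rw [← not_iff_not, not_not, ← Matrix.exists_mulVec_eq_zero_iff]
  simp only [Nondegenerate, not_forall, not_not, exists_prop]
  refine exists_congr fun v => and_congr_right fun _ => ⟨?_, fun h => ?_⟩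
  · rintro ⟨a, ha⟩
    funext i
    have h0 : cov[fun ω => U ω i, fun ω => v ⬝ᵥ U ω; μ] = 0 := by
      have hm : ∫ ω, v ⬝ᵥ U ω ∂μ = a := by rw [integral_congr_ae ha]; simp
      rw [covariance, hm]
      refine integral_eq_zero_of_ae ?_
      filter_upwards [ha] with ω hω
      simp [hω]
    rw [key v _ (hU i)] at h0
    simpa [mulVec, dotProduct] using h0
  · refine ⟨_, ae_eq_integral_of_variance_eq_zero (hL v) ?_⟩
    rw [← covariance_self (hL v).aemeasurable, key v _ (hL v)]
    have h1 : ∀ i, cov[fun ω => U ω i, fun ω => v ⬝ᵥ U ω; μ] = 0 := fun i => by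
      rw [key v _ (hU i)]
      simpa [mulVec, dotProduct] using congrFun h i
    exact Finset.sum_eq_zero fun j _ => by rw [covariance_comm, h1 j, zero_mul]

/-- The four conditions that characterize a linear conditional mean. The gamma law
with shape `θ` and rate `α` is `gammaMeasure θ α`. -/
structure ProductGammaConditions {Ω : Type*} [MeasurableSpace Ω] (μ : Measure Ω) {k n : ℕ}
    (A : Matrix (Fin k) (Fin n) ℝ) (lam : Fin k → ℝ) (X : Ω → Fin n → ℝ)
    (C : Matrix (Fin n) (Fin k) ℝ) (b : Fin n → ℝ) : Prop where
  dark_current_eq_zero : lam = 0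
  isDiag : (A * C).IsDiag
  diag_mem : ∀ i, 0 < (A * C) i i ∧ (A * C) i i < 1
  pos : ∀ i, 0 < (A *ᵥ b) i
  law : μ.map (fun ω => A *ᵥ X ω) =
    Measure.pi fun i =>
      gammaMeasure ((A *ᵥ b) i / (A * C) i i) ((1 - (A * C) i i) / (A * C) i i)

end PoissonChannel

end

/-!
Let `U = A X + λ` and `m(y) = E ∏ᵢ Uᵢ^{yᵢ} e^{-Uᵢ}`. Since `P(Y = y) = m(y) / ∏ᵢ yᵢ!` and
`E[Uᵢ; Y = y] = m(y + eᵢ) / ∏ᵢ yᵢ!`, the conditional mean of `U` given `Y = y` is `H y + c` for all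
`y` if and only if `m` is positive and `m(y + eᵢ) = (H y + c)ᵢ m(y)`; here `H = A C` and
`c = A b + λ`.

Positivity forces `c > 0` and `H ≥ 0`, and the symmetry of `y + eᵢ + eⱼ` in `i` and `j` gives
`H i l * H j i = H j l * H i j`: the combination `H j i • eᵢ - H i j • eⱼ` is in the left kernel
of `H`. A vector `v` in this kernel makes `v ⬝ᵥ U` almost surely constant, so by non-degeneracy the
kernel is trivial and `H` is diagonal with positive diagonal. If `H i i ≥ 1`, the sequence
`n ↦ m(n eᵢ) / n!`, which is summable because `∑ₙ Uᵢⁿ / n! = e^{Uᵢ}`, would dominate a multiple of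
the harmonic series.

The recursion determines `m` up to a factor, that is, the moments of the law of `U` tilted by
`e^{-∑ᵢ Uᵢ}`. Linear functions have exponential moments under the tilted law, so its moments
determine it, and with it the law of `U`. The product gamma law with the stated parameters
satisfies the same recursion. Its support reaches the origin while `U ≥ λ`, hence `λ = 0`.
-/

namespace PoissonChannel

open scoped Topology

section MomentProblem

variable {Ω Ω' : Type*} [MeasurableSpace Ω] [MeasurableSpace Ω'] {μ : Measure Ω} {μ' : Measure Ω'}
  {V : Ω → ℝ} {W : Ω' → ℝ}

theorem complexMGF_eventuallyEq_of_moment_eq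
    (hV : 0 ∈ interior (integrableExpSet V μ)) (hW : 0 ∈ interior (integrableExpSet W μ'))
    (h : ∀ n : ℕ, ∫ ω, V ω ^ n ∂μ = ∫ ω, W ω ^ n ∂μ') :
    complexMGF V μ =ᶠ[𝓝 0] complexMGF W μ' := by
  have hderiv : ∀ n, iteratedDeriv n (complexMGF V μ) 0 = iteratedDeriv n (complexMGF W μ') 0 := by
    intro n
    rw [iteratedDeriv_complexMGF (by simpa using hV), iteratedDeriv_complexMGF (by simpa using hW)]
    simpa [← integral_complex_ofReal] using congrArg ((↑) : ℝ → ℂ) (h n)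
  have hseriesV := (analyticAt_complexMGF (z := 0)
    (by simpa using hV)).hasFPowerSeriesAt.eventually_hasSum_sub
  have hseriesW := (analyticAt_complexMGF (z := 0)
    (by simpa using hW)).hasFPowerSeriesAt.eventually_hasSum_sub
  simp only [hderiv] at hseriesV
  filter_upwards [hseriesV, hseriesW] with z hzV hzW using hzV.unique hzW

theorem map_eq_map_of_moment_eq [IsFiniteMeasure μ] [IsFiniteMeasure μ']
    (hV : 0 ∈ interior (integrableExpSet V μ)) (hW : 0 ∈ interior (integrableExpSet W μ'))
    (h : ∀ n : ℕ, ∫ ω, V ω ^ n ∂μ = ∫ ω, W ω ^ n ∂μ') :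
    μ.map V = μ'.map W := by
  set strip : Set ℂ :=
    {z | z.re ∈ interior (integrableExpSet V μ) ∩ interior (integrableExpSet W μ')}
  have hconn : IsPreconnected strip :=
    ((convex_integrableExpSet.interior.inter convex_integrableExpSet.interior).linear_preimage
      Complex.reLm).isPreconnected
  have hstrip : ∀ t : ℝ, t * Complex.I ∈ strip := fun t => ⟨by simpa using hV, by simpa using hW⟩
  have heq : Set.EqOn (complexMGF V μ) (complexMGF W μ') strip :=
    (analyticOnNhd_complexMGF.mono fun z hz => hz.1).eqOn_of_preconnected_of_eventuallyEq
      (analyticOnNhd_complexMGF.mono fun z hz => hz.2) hconn (by simpa using hstrip 0)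
      (complexMGF_eventuallyEq_of_moment_eq hV hW h)
  refine Measure.ext_of_charFun (funext fun t => ?_)
  rw [← complexMGF_mul_I (aemeasurable_of_mem_interior_integrableExpSet hV),
    ← complexMGF_mul_I (aemeasurable_of_mem_interior_integrableExpSet hW)]
  exact heq (hstrip t)

end MomentProblem

variable {ι : Type*} [Fintype ι]

section MultivariateMomentProblem

variable {P Q : Measure (ι → ℝ)} [IsFiniteMeasure P] [IsFiniteMeasure Q]

theorem integrable_prod_pow (hP : ∀ i, 0 ∈ interior (integrableExpSet (fun u => u i) P))
    (y : ι → ℕ) : Integrable (fun u => ∏ i, u i ^ y i) P := by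
  let S : Submonoid ((ι → ℝ) → ℝ) :=
    { carrier := {f | ∀ p : NNReal, MemLp f p P}
      one_mem' := fun p => memLp_const 1
      mul_mem' := fun {f g} hf hg p => by
        have : ENNReal.HolderTriple ((2 * p : NNReal) : ENNReal) ((2 * p : NNReal) : ENNReal) p :=
          ⟨by
            push_cast
            rw [ENNReal.mul_inv (by simp) (by simp), ← add_mul, ENNReal.inv_two_add_inv_two,
              one_mul]⟩
        exact (hg (2 * p)).mul (hf (2 * p)) }
  have heval : ∀ i, (fun u : ι → ℝ => u i) ∈ S :=
    fun i p => memLp_of_mem_interior_integrableExpSet (hP i) p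
  have hprod : ∏ i, (fun u : ι → ℝ => u i) ^ y i ∈ S :=
    prod_mem fun i _ => pow_mem (heval i) (y i)
  simpa [Finset.prod_fn] using memLp_one_iff_integrable.1 (hprod 1)

theorem integral_dotProduct_pow [DecidableEq ι]
    (hP : ∀ i, 0 ∈ interior (integrableExpSet (fun u => u i) P)) (t : ι → ℝ) (n : ℕ) :
    ∫ u, (t ⬝ᵥ u) ^ n ∂P = ∑ y ∈ Finset.piAntidiag Finset.univ n,
      Nat.multinomial Finset.univ y * (∏ i, t i ^ y i) * ∫ u, ∏ i, u i ^ y i ∂P := by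
  simp only [dotProduct, Finset.sum_pow_eq_sum_piAntidiag, mul_pow, Finset.prod_mul_distrib,
    ← mul_assoc]
  rw [integral_finsetSum _ fun y _ => (integrable_prod_pow hP y).const_mul _]
  simp only [integral_const_mul]

theorem ext_of_integral_prod_pow_eq
    (hP : ∀ t : ι → ℝ, 0 ∈ interior (integrableExpSet (fun u => t ⬝ᵥ u) P))
    (hQ : ∀ t : ι → ℝ, 0 ∈ interior (integrableExpSet (fun u => t ⬝ᵥ u) Q))
    (h : ∀ y : ι → ℕ, ∫ u, ∏ i, u i ^ y i ∂P = ∫ u, ∏ i, u i ^ y i ∂Q) : P = Q := by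
  classical
  refine Measure.ext_of_charFunDual (funext fun L => ?_)
  obtain ⟨t, ht⟩ := (dotProductEquiv ℝ ι).surjective (L : (ι → ℝ) →ₗ[ℝ] ℝ)
  have hL : (L : (ι → ℝ) → ℝ) = fun u => t ⬝ᵥ u := funext fun u => (DFunLike.congr_fun ht u).symm
  have hmap : P.map (fun u => t ⬝ᵥ u) = Q.map (fun u => t ⬝ᵥ u) :=
    map_eq_map_of_moment_eq (hP t) (hQ t) fun n => by
      rw [integral_dotProduct_pow (fun i => by simpa using hP (Pi.single i 1)),
        integral_dotProduct_pow (fun i => by simpa using hQ (Pi.single i 1))]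
      simp only [h]
  rw [charFunDual_eq_charFun_map_one, charFunDual_eq_charFun_map_one, hL, hmap]

end MultivariateMomentProblem

/-- The likelihood `∏ᵢ uᵢ^{yᵢ} e^{-uᵢ}` of the counts `y` under independent Poisson laws with
intensities `u`, without the factor `∏ᵢ 1 / yᵢ!`, so that raising `yᵢ` by one multiplies it
by `uᵢ`. -/
noncomputable def poissonWeight (y : ι → ℕ) (u : ι → ℝ) : ℝ :=
  ∏ i, (u i ^ y i * Real.exp (-u i))

/-- The moment `∫ ∏ᵢ uᵢ^{yᵢ} e^{-uᵢ} dP(u)`: up to the factor `∏ᵢ 1 / yᵢ!`, the probability of the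
counts `y` when the intensities have law `P`. -/
noncomputable def poissonMoment (P : Measure (ι → ℝ)) (y : ι → ℕ) : ℝ :=
  ∫ u, poissonWeight y u ∂P

section PoissonWeight

@[fun_prop]
theorem measurable_poissonWeight (y : ι → ℕ) : Measurable (poissonWeight y) := by
  unfold poissonWeight; fun_prop

theorem poissonWeight_eq_exp_mul_prod_pow (y : ι → ℕ) (u : ι → ℝ) :
    poissonWeight y u = Real.exp (-∑ i, u i) * ∏ i, u i ^ y i := by
  rw [poissonWeight, Finset.prod_mul_distrib, ← Real.exp_sum, Finset.sum_neg_distrib, mul_comm]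

theorem poissonWeight_zero (u : ι → ℝ) : poissonWeight 0 u = Real.exp (-∑ i, u i) := by
  simp [poissonWeight_eq_exp_mul_prod_pow]

theorem poissonWeight_single [DecidableEq ι] (i : ι) (n : ℕ) (u : ι → ℝ) :
    poissonWeight (Pi.single i n) u = Real.exp (-∑ j, u j) * u i ^ n := by
  rw [poissonWeight_eq_exp_mul_prod_pow,
    Finset.prod_eq_single i (fun j _ hj => by simp [hj]) (by simp), Pi.single_eq_same]

theorem poissonWeight_add_single [DecidableEq ι] (y : ι → ℕ) (i : ι) (u : ι → ℝ) :
    poissonWeight (y + Pi.single i 1) u = u i * poissonWeight y u := by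
  have hpow : ∏ j, u j ^ (Pi.single i 1 : ι → ℕ) j = u i := by
    rw [Finset.prod_eq_single i (fun j _ hj => by simp [hj]) (by simp), Pi.single_eq_same, pow_one]
  simp only [poissonWeight_eq_exp_mul_prod_pow, Pi.add_apply, pow_add, Finset.prod_mul_distrib,
    hpow]
  ring

theorem poissonWeight_nonneg (y : ι → ℕ) {u : ι → ℝ} (hu : 0 ≤ u) : 0 ≤ poissonWeight y u :=
  Finset.prod_nonneg fun i _ => mul_nonneg (pow_nonneg (hu i) _) (Real.exp_pos _).le

theorem toReal_ofReal_poissonWeight_div_smul {E : Type*} [AddCommGroup E] [Module ℝ E]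
    (y : ι → ℕ) {u : ι → ℝ} (hu : 0 ≤ u) (e : E) :
    (ENNReal.ofReal (poissonWeight y u / ∏ i, ((y i).factorial : ℝ))).toReal • e =
      (∏ i, ((y i).factorial : ℝ))⁻¹ • poissonWeight y u • e := by
  rw [ENNReal.toReal_ofReal (div_nonneg (poissonWeight_nonneg y hu) (by positivity)),
    div_eq_inv_mul, mul_smul]

theorem poissonWeight_le_prod_factorial (y : ι → ℕ) {u : ι → ℝ} (hu : 0 ≤ u) :
    poissonWeight y u ≤ ∏ i, ((y i).factorial : ℝ) := by
  refine Finset.prod_le_prod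
    (fun i _ => mul_nonneg (pow_nonneg (hu i) _) (Real.exp_pos _).le) fun i _ => ?_
  rw [Real.exp_neg, ← div_eq_mul_inv, div_le_comm₀ (Real.exp_pos _) (by positivity)]
  exact Real.pow_div_factorial_le_exp (u i) (hu i) (y i)

theorem sum_poissonWeight_single_div_factorial_le_one [DecidableEq ι] {u : ι → ℝ} (hu : 0 ≤ u)
    (i : ι) (N : ℕ) :
    ∑ n ∈ Finset.range N, poissonWeight (Pi.single i n) u / n.factorial ≤ 1 := by
  simp only [poissonWeight_single, mul_div_assoc, ← Finset.mul_sum]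
  rw [Real.exp_neg, inv_mul_le_iff₀ (Real.exp_pos _), mul_one]
  calc ∑ n ∈ Finset.range N, u i ^ n / n.factorial ≤ Real.exp (u i) :=
        Real.sum_le_exp_of_nonneg (hu i) N
    _ ≤ Real.exp (∑ j, u j) :=
        Real.exp_le_exp.2 (Finset.single_le_sum (fun j _ => hu j) (Finset.mem_univ i))

variable {P : Measure (ι → ℝ)} [IsFiniteMeasure P]

theorem integrable_poissonWeight (hP : ∀ᵐ u ∂P, 0 ≤ u) (y : ι → ℕ) :
    Integrable (poissonWeight y) P := by
  refine Integrable.of_bound (by fun_prop) (∏ i, ((y i).factorial : ℝ)) ?_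
  filter_upwards [hP] with u hu
  rw [Real.norm_of_nonneg (poissonWeight_nonneg y hu)]
  exact poissonWeight_le_prod_factorial y hu

theorem integrable_exp_neg_sum (hP : ∀ᵐ u ∂P, 0 ≤ u) :
    Integrable (fun u => Real.exp (-∑ i, u i)) P := by
  simpa only [funext poissonWeight_zero] using integrable_poissonWeight hP 0

theorem integrable_poissonWeight_smul (hP : ∀ᵐ u ∂P, 0 ≤ u) (y : ι → ℕ) :
    Integrable (fun u => poissonWeight y u • u) P := by
  classical
  refine Integrable.of_eval fun i => ?_
  simpa only [Pi.smul_apply, smul_eq_mul, mul_comm (poissonWeight y _),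
    ← poissonWeight_add_single] using integrable_poissonWeight hP (y + Pi.single i 1)

theorem integral_poissonWeight_smul_apply [DecidableEq ι] (hP : ∀ᵐ u ∂P, 0 ≤ u) (y : ι → ℕ)
    (i : ι) : (∫ u, poissonWeight y u • u ∂P) i = poissonMoment P (y + Pi.single i 1) := by
  rw [eval_integral fun j => (integrable_poissonWeight_smul hP y).eval j]
  simp only [poissonMoment, poissonWeight_add_single, Pi.smul_apply, smul_eq_mul, mul_comm]

theorem summable_poissonMoment_single_div_factorial [DecidableEq ι] (hP : ∀ᵐ u ∂P, 0 ≤ u)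
    (i : ι) : Summable fun n : ℕ => poissonMoment P (Pi.single i n) / n.factorial := by
  have hint : ∀ n : ℕ, Integrable (fun u => poissonWeight (Pi.single i n) u / n.factorial) P :=
    fun n => (integrable_poissonWeight hP _).div_const _
  refine summable_of_sum_range_le (c := ∫ _, (1 : ℝ) ∂P) (fun n => ?_) fun N => ?_
  · refine div_nonneg (integral_nonneg_of_ae ?_) (by positivity)
    filter_upwards [hP] with u hu using poissonWeight_nonneg _ hu
  · simp only [poissonMoment, ← integral_div]
    rw [← integral_finsetSum _ fun n _ => hint n]
    refine integral_mono_ae (integrable_finsetSum _ fun n _ => hint n) (integrable_const 1) ?_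
    filter_upwards [hP] with u hu using sum_poissonWeight_single_div_factorial_le_one hu i N

end PoissonWeight

section Determinacy

theorem mul_apply_le_one_of_abs_lt {t : ι → ℝ} {s : ℝ} (hs : |s| < (1 + ∑ i, |t i|)⁻¹) (i : ι) :
    s * t i ≤ 1 := by
  have hti : |t i| ≤ 1 + ∑ j, |t j| :=
    (Finset.single_le_sum (fun j _ => abs_nonneg (t j)) (Finset.mem_univ i)).trans (by simp)
  calc s * t i ≤ |s| * |t i| := (le_abs_self _).trans_eq (abs_mul _ _)
    _ ≤ (1 + ∑ j, |t j|)⁻¹ * (1 + ∑ j, |t j|) := by gcongr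
    _ = 1 := inv_mul_cancel₀ (by positivity)

theorem zero_mem_interior_integrableExpSet_tilted {P : Measure (ι → ℝ)} [IsFiniteMeasure P]
    (hP : ∀ᵐ u ∂P, 0 ≤ u) (t : ι → ℝ) :
    0 ∈ interior (integrableExpSet (fun u => t ⬝ᵥ u) (P.tilted fun u => -∑ i, u i)) := by
  have hradius : 0 < (1 + ∑ i, |t i|)⁻¹ := by positivity
  rw [mem_interior_iff_mem_nhds]
  refine Filter.mem_of_superset (Metric.ball_mem_nhds 0 hradius) fun s hs => ?_
  rw [mem_ball_zero_iff, Real.norm_eq_abs] at hs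
  refine (integrable_tilted_iff (integrable_exp_neg_sum hP) _).2
    (Integrable.of_bound (by fun_prop) 1 ?_)
  filter_upwards [hP] with u hu
  rw [smul_eq_mul, Real.norm_of_nonneg (by positivity), ← Real.exp_add, Real.exp_le_one_iff,
    dotProduct, Finset.mul_sum, neg_add_nonpos_iff]
  refine Finset.sum_le_sum fun i _ => ?_
  rw [← mul_assoc]
  exact mul_le_of_le_one_left (hu i) (mul_apply_le_one_of_abs_lt hs i)

theorem integral_prod_pow_tilted (P : Measure (ι → ℝ)) (y : ι → ℕ) :
    ∫ u, ∏ i, u i ^ y i ∂(P.tilted fun u => -∑ i, u i) = poissonMoment P y / poissonMoment P 0 := by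
  simp only [integral_tilted, poissonMoment, poissonWeight_eq_exp_mul_prod_pow y,
    poissonWeight_zero, smul_eq_mul, ← integral_div, div_mul_eq_mul_div]

theorem eq_of_poissonMoment_div_eq {P Q : Measure (ι → ℝ)} [IsProbabilityMeasure P]
    [IsProbabilityMeasure Q] (hP : ∀ᵐ u ∂P, 0 ≤ u) (hQ : ∀ᵐ u ∂Q, 0 ≤ u)
    (h : ∀ y, poissonMoment P y / poissonMoment P 0 = poissonMoment Q y / poissonMoment Q 0) :
    P = Q := by
  have hexpP := integrable_exp_neg_sum hP
  have hexpQ := integrable_exp_neg_sum hQ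
  have := isProbabilityMeasure_tilted hexpP
  have := isProbabilityMeasure_tilted hexpQ
  rw [← tilted_neg_same hexpP, ← tilted_neg_same hexpQ]
  congr 1
  refine ext_of_integral_prod_pow_eq (zero_mem_interior_integrableExpSet_tilted hP)
    (zero_mem_interior_integrableExpSet_tilted hQ) fun y => ?_
  rw [integral_prod_pow_tilted, integral_prod_pow_tilted, h]

end Determinacy

section AffineRecursion

theorem induction_add_single {κ : Type*} [Finite κ] [DecidableEq κ] {p : (κ → ℕ) → Prop}
    (zero : p 0) (add_single : ∀ y i, p y → p (y + Pi.single i 1)) (y : κ → ℕ) : p y := by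
  induction y using WellFoundedLT.induction with
  | ind y ih =>
    by_cases hy : y = 0
    · exact hy ▸ zero
    · obtain ⟨i, hi⟩ := Function.ne_iff.1 hy
      have hle : Pi.single i 1 ≤ y := fun j => by
        rcases eq_or_ne j i with rfl | hj
        · simpa using Nat.one_le_iff_ne_zero.2 hi
        · simp [hj]
      obtain ⟨z, rfl⟩ := exists_add_of_le hle
      rw [add_comm]
      exact add_single z i (ih z (lt_add_of_pos_left z (by simp)))

/-- The coefficients `H y + c` of an affine recursion on `ℕ^ι`. -/
def affineCoeff (H : Matrix ι ι ℝ) (c : ι → ℝ) (y : ι → ℕ) : ι → ℝ :=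
  (H *ᵥ fun j => (y j : ℝ)) + c

@[simp]
theorem affineCoeff_zero (H : Matrix ι ι ℝ) (c : ι → ℝ) : affineCoeff H c 0 = c := by
  simp [affineCoeff, ← Pi.zero_def]

variable [DecidableEq ι]

/-- A positive array on `ℕ^ι` for which a step in direction `i` multiplies the entry at `y` by
`(H y + c)ᵢ`. For the Poisson moments of the intensities this says that their conditional mean given
the counts `y` is `H y + c`. -/
structure AffineRecursion (m : (ι → ℕ) → ℝ) (H : Matrix ι ι ℝ) (c : ι → ℝ) : Prop where
  pos : ∀ y, 0 < m y
  step : ∀ y i, m (y + Pi.single i 1) = affineCoeff H c y i * m y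

theorem affineCoeff_add_single (H : Matrix ι ι ℝ) (c : ι → ℝ) (y : ι → ℕ) (i : ι) (n : ℕ) (j : ι) :
    affineCoeff H c (y + Pi.single i n) j = affineCoeff H c y j + n * H j i := by
  have hcast : (fun l => (((y + Pi.single i n : ι → ℕ) l : ℕ) : ℝ)) =
      (fun l => (y l : ℝ)) + Pi.single i (n : ℝ) := by
    ext l
    rcases eq_or_ne l i with rfl | hl <;> simp [*]
  rw [affineCoeff, hcast, mulVec_add, mulVec_single, affineCoeff]
  simp only [Pi.add_apply, Pi.smul_apply, col_apply, MulOpposite.smul_eq_mul_unop,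
    MulOpposite.unop_op]
  ring

theorem affineCoeff_single (H : Matrix ι ι ℝ) (c : ι → ℝ) (i : ι) (n : ℕ) (j : ι) :
    affineCoeff H c (Pi.single i n) j = c j + n * H j i := by
  simpa using affineCoeff_add_single H c 0 i n j

namespace AffineRecursion

variable {m m' : (ι → ℕ) → ℝ} {H : Matrix ι ι ℝ} {c : ι → ℝ}

theorem affineCoeff_pos (h : AffineRecursion m H c) (y : ι → ℕ) (i : ι) :
    0 < affineCoeff H c y i :=
  pos_of_mul_pos_left (h.step y i ▸ h.pos (y + Pi.single i 1)) (h.pos y).le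

theorem offset_pos (h : AffineRecursion m H c) (i : ι) : 0 < c i := by
  simpa using h.affineCoeff_pos 0 i

theorem entry_nonneg (h : AffineRecursion m H c) (i j : ι) : 0 ≤ H i j := by
  by_contra! hneg
  obtain ⟨n, hn⟩ := exists_nat_gt (c i / -H i j)
  rw [div_lt_iff₀ (neg_pos.2 hneg)] at hn
  have hpos := h.affineCoeff_pos (Pi.single j n) i
  rw [affineCoeff_single] at hpos
  linarith

/-- The two orders of stepping from `y` to `y + eᵢ + eⱼ` must agree. -/
theorem affineCoeff_mul_comm (h : AffineRecursion m H c) (y : ι → ℕ) (i j : ι) :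
    affineCoeff H c y i * H j i = affineCoeff H c y j * H i j := by
  have hij := h.step (y + Pi.single i 1) j
  have hji := h.step (y + Pi.single j 1) i
  rw [add_right_comm, hji, h.step, h.step, affineCoeff_add_single, affineCoeff_add_single] at hij
  apply mul_right_cancel₀ (h.pos y).ne'
  push_cast at hij
  linarith

theorem entry_mul_comm (h : AffineRecursion m H c) (i j l : ι) :
    H i l * H j i = H j l * H i j := by
  have hsingle := h.affineCoeff_mul_comm (Pi.single l 1) i j
  have hzero := h.affineCoeff_mul_comm 0 i j
  simp only [affineCoeff_single, affineCoeff_zero, Nat.cast_one, one_mul] at hsingle hzero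
  linarith

theorem isDiag (h : AffineRecursion m H c) (hH : ∀ v, v ᵥ* H = 0 → v = 0) : H.IsDiag := by
  intro i j hij
  have hv : (Pi.single i (H j i) - Pi.single j (H i j)) ᵥ* H = 0 := by
    funext l
    simp only [sub_vecMul, single_vecMul, Pi.sub_apply, Pi.smul_apply, Pi.zero_apply, row_apply,
      smul_eq_mul]
    linarith [h.entry_mul_comm i j l]
  simpa [hij] using congrFun (hH _ hv) j

theorem diag_pos (h : AffineRecursion m H c) (hH : ∀ v, v ᵥ* H = 0 → v = 0) (i : ι) :
    0 < H i i := by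
  refine (h.entry_nonneg i i).lt_of_ne' fun hzero => ?_
  have hv : Pi.single i 1 ᵥ* H = 0 := by
    funext l
    rcases eq_or_ne i l with rfl | hl
    · simpa using hzero
    · simpa using h.isDiag hH hl
  simpa using congrFun (hH _ hv) i

theorem div_apply_zero_eq (h : AffineRecursion m H c) (h' : AffineRecursion m' H c) (y : ι → ℕ) :
    m y / m 0 = m' y / m' 0 := by
  induction y using induction_add_single with
  | zero => rw [div_self (h.pos 0).ne', div_self (h'.pos 0).ne']
  | add_single y i ih => rw [h.step, h'.step, mul_div_assoc, mul_div_assoc, ih]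

theorem eq_of_poissonMoment {P Q : Measure (ι → ℝ)} [IsProbabilityMeasure P]
    [IsProbabilityMeasure Q] (hP : ∀ᵐ u ∂P, 0 ≤ u) (hQ : ∀ᵐ u ∂Q, 0 ≤ u)
    (h : AffineRecursion (poissonMoment P) H c) (h' : AffineRecursion (poissonMoment Q) H c) :
    P = Q :=
  eq_of_poissonMoment_div_eq hP hQ (h.div_apply_zero_eq h')

end AffineRecursion

end AffineRecursion

section Nondegeneracy

theorem integrable_dotProduct_sub_mul {P : Measure (ι → ℝ)} {g : (ι → ℝ) → ℝ}
    (hg : Integrable g P) (hug : ∀ i, Integrable (fun u => u i * g u) P) (v : ι → ℝ) (a : ℝ) :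
    Integrable (fun u => (v ⬝ᵥ u - a) * g u) P := by
  simp only [sub_mul, dotProduct, Finset.sum_mul, mul_assoc]
  exact (integrable_finsetSum _ fun i _ => (hug i).const_mul _).sub (hg.const_mul a)

theorem integral_dotProduct_sub_mul {P : Measure (ι → ℝ)} {g : (ι → ℝ) → ℝ}
    (hg : Integrable g P) (hug : ∀ i, Integrable (fun u => u i * g u) P) (v : ι → ℝ) (a : ℝ) :
    ∫ u, (v ⬝ᵥ u - a) * g u ∂P = ∑ i, v i * ∫ u, u i * g u ∂P - a * ∫ u, g u ∂P := by
  simp only [sub_mul, dotProduct, Finset.sum_mul, mul_assoc]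
  rw [integral_sub (integrable_finsetSum _ fun i _ => (hug i).const_mul _) (hg.const_mul a),
    integral_finsetSum _ fun i _ => (hug i).const_mul _]
  simp only [integral_const_mul]

variable [DecidableEq ι] {P : Measure (ι → ℝ)} [IsFiniteMeasure P] {H : Matrix ι ι ℝ} {c : ι → ℝ}

namespace AffineRecursion

theorem integral_dotProduct_sub_mul_poissonWeight_eq_zero (hP : ∀ᵐ u ∂P, 0 ≤ u)
    (h : AffineRecursion (poissonMoment P) H c) {v : ι → ℝ} (hv : v ᵥ* H = 0) (y : ι → ℕ) :
    ∫ u, (v ⬝ᵥ u - v ⬝ᵥ c) * poissonWeight y u ∂P = 0 := by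
  have hcoeff : v ⬝ᵥ affineCoeff H c y = v ⬝ᵥ c := by
    rw [affineCoeff, dotProduct_add, dotProduct_mulVec, hv, zero_dotProduct, zero_add]
  have hstep : ∀ i, ∫ u, u i * poissonWeight y u ∂P = affineCoeff H c y i * poissonMoment P y :=
    fun i => by rw [← h.step, poissonMoment]; simp only [poissonWeight_add_single]
  rw [integral_dotProduct_sub_mul (integrable_poissonWeight hP y)
    fun i => by simpa only [← poissonWeight_add_single] using integrable_poissonWeight hP _]
  simp only [hstep, ← mul_assoc, ← Finset.sum_mul]
  rw [← dotProduct, hcoeff, poissonMoment, sub_self]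

/-- The centred combination `v ⬝ᵥ u - v ⬝ᵥ c` is orthogonal to all Poisson weights, and its product
with the weight at `0` is a combination of such weights; so its weighted second moment vanishes. -/
theorem ae_dotProduct_eq (hP : ∀ᵐ u ∂P, 0 ≤ u) (h : AffineRecursion (poissonMoment P) H c)
    {v : ι → ℝ} (hv : v ᵥ* H = 0) : ∀ᵐ u ∂P, v ⬝ᵥ u = v ⬝ᵥ c := by
  set f : (ι → ℝ) → ℝ := fun u => v ⬝ᵥ u - v ⬝ᵥ c
  have hint : ∀ y, Integrable (fun u => f u * poissonWeight y u) P := fun y =>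
    integrable_dotProduct_sub_mul (integrable_poissonWeight hP y)
      (fun i => by simpa only [← poissonWeight_add_single] using integrable_poissonWeight hP _) _ _
  have hzero : ∀ y, ∫ u, f u * poissonWeight y u ∂P = 0 :=
    h.integral_dotProduct_sub_mul_poissonWeight_eq_zero hP hv
  have hsingle : ∀ i u, u i * (f u * poissonWeight 0 u) =
      f u * poissonWeight (0 + Pi.single i 1) u := fun i u => by
    rw [poissonWeight_add_single, mul_left_comm]
  have hintsingle : ∀ i, Integrable (fun u => u i * (f u * poissonWeight 0 u)) P :=
    fun i => by simpa only [hsingle] using hint _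
  have hsq : ∫ u, f u * (f u * poissonWeight 0 u) ∂P = 0 := by
    rw [integral_dotProduct_sub_mul (hint 0) hintsingle]
    simp only [hsingle, hzero, mul_zero, Finset.sum_const_zero, sub_zero]
  have hnonneg : 0 ≤ fun u => f u * (f u * poissonWeight 0 u) := fun u => by
    change 0 ≤ f u * (f u * poissonWeight 0 u)
    rw [poissonWeight_zero, ← mul_assoc]
    exact mul_nonneg (mul_self_nonneg _) (Real.exp_pos _).le
  rw [integral_eq_zero_iff_of_nonneg hnonneg
    (integrable_dotProduct_sub_mul (hint 0) hintsingle _ _)] at hsq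
  filter_upwards [hsq] with u hu
  simpa [f, poissonWeight_zero, sub_eq_zero] using hu

end AffineRecursion

end Nondegeneracy

section DiagLtOne

/-- Comparison with the harmonic series: `n p(n)` is nondecreasing for `n ≥ 1`. -/
theorem not_summable_of_mul_le_succ_mul {p : ℕ → ℝ} (hp : 0 < p 1)
    (h : ∀ n : ℕ, (n + 1) * p (n + 1) ≤ (n + 2) * p (n + 2)) : ¬ Summable p := by
  intro hsum
  have hle : ∀ n : ℕ, p 1 ≤ (n + 1) * p (n + 1) := fun n => by
    induction n with
    | zero => simp
    | succ n ih => exact ih.trans ((h n).trans_eq (by push_cast; ring_nf))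
  have hharmonic : Summable fun n : ℕ => p 1 * (1 / ((n + 1 : ℕ) : ℝ)) := by
    refine ((summable_nat_add_iff 1).2 hsum).of_nonneg_of_le (fun n => by positivity) fun n => ?_
    rw [mul_one_div, div_le_iff₀ (by positivity), mul_comm]
    exact_mod_cast hle n
  rw [summable_mul_left_iff hp.ne'] at hharmonic
  exact Real.not_summable_one_div_natCast ((summable_nat_add_iff 1).1 hharmonic)

theorem AffineRecursion.diag_lt_one [DecidableEq ι] {P : Measure (ι → ℝ)} [IsFiniteMeasure P]
    (hP : ∀ᵐ u ∂P, 0 ≤ u) {H : Matrix ι ι ℝ} {c : ι → ℝ}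
    (h : AffineRecursion (poissonMoment P) H c) (i : ι) : H i i < 1 := by
  by_contra! hge
  set p : ℕ → ℝ := fun n => poissonMoment P (Pi.single i n) / n.factorial with hp
  have hpos : ∀ n, 0 < p n := fun n => div_pos (h.pos _) (by positivity)
  have hstep : ∀ n : ℕ, (n + 1) * p (n + 1) = (c i + n * H i i) * p n := fun n => by
    simp only [hp, Pi.single_add, h.step, affineCoeff_single, Nat.factorial_succ]
    push_cast
    field_simp
  refine not_summable_of_mul_le_succ_mul (hpos 1) (fun n => ?_)
    (summable_poissonMoment_single_div_factorial hP i)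
  calc (n + 1) * p (n + 1) ≤ (c i + ↑(n + 1) * H i i) * p (n + 1) := by
        refine mul_le_mul_of_nonneg_right ?_ (hpos _).le
        push_cast
        nlinarith [h.offset_pos i]
    _ = (n + 2) * p (n + 2) := by
        rw [← hstep]
        push_cast
        ring

end DiagLtOne

section Gamma

theorem measurable_gammaPDF (a r : ℝ) : Measurable (gammaPDF a r) :=
  (measurable_gammaPDFReal a r).ennreal_ofReal

theorem ae_nonneg_gammaMeasure (a r : ℝ) : ∀ᵐ x ∂gammaMeasure a r, 0 ≤ x := by
  rw [gammaMeasure, ae_withDensity_iff (measurable_gammaPDF a r)]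
  refine .of_forall fun x hx => ?_
  by_contra! hneg
  exact hx (gammaPDF_of_neg hneg)

theorem nonpos_of_ae_le_gammaMeasure {a r l : ℝ} (ha : 0 < a) (hr : 0 < r)
    (h : ∀ᵐ x ∂gammaMeasure a r, l ≤ x) : l ≤ 0 := by
  by_contra! hl
  rw [gammaMeasure, ae_withDensity_iff (measurable_gammaPDF a r)] at h
  have hnull : volume (Set.Ioo 0 l) = 0 := by
    refine measure_mono_null (fun x hx => ?_) h
    simp only [Set.mem_compl_iff, Set.mem_ofPred_eq, not_forall, not_le]
    exact ⟨by simpa [gammaPDF] using gammaPDFReal_pos ha hr hx.1, hx.2⟩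
  simp [hl.not_ge] at hnull

theorem integral_gammaMeasure {a r : ℝ} (ha : 0 < a) (hr : 0 < r) (f : ℝ → ℝ) :
    ∫ x, f x ∂gammaMeasure a r = ∫ x in Set.Ioi 0, gammaPDFReal a r x * f x := by
  have htoReal : ∀ x, (gammaPDF a r x).toReal = gammaPDFReal a r x := fun x =>
    ENNReal.toReal_ofReal (gammaPDFReal_nonneg ha hr x)
  rw [gammaMeasure, integral_withDensity_eq_integral_toReal_smul (measurable_gammaPDF a r)
    (.of_forall fun x => by simp [gammaPDF]), ← integral_Ici_eq_integral_Ioi]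
  simp only [htoReal, smul_eq_mul]
  refine (setIntegral_eq_integral_of_forall_compl_eq_zero fun x hx => ?_).symm
  rw [Set.mem_Ici] at hx
  simp [gammaPDFReal, hx]

theorem integral_pow_mul_exp_neg_gammaMeasure {a r : ℝ} (ha : 0 < a) (hr : 0 < r) (n : ℕ) :
    ∫ x, x ^ n * Real.exp (-x) ∂gammaMeasure a r =
      r ^ a / Real.Gamma a * ((1 / (r + 1)) ^ (a + n) * Real.Gamma (a + n)) := by
  rw [integral_gammaMeasure ha hr,
    ← Real.integral_rpow_mul_exp_neg_mul_Ioi (by positivity) (by positivity), ← integral_const_mul]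
  refine setIntegral_congr_fun measurableSet_Ioi fun x (hx : 0 < x) => ?_
  have hpow : x ^ (a + n - 1) = x ^ (a - 1) * x ^ n := by
    rw [add_sub_right_comm, Real.rpow_add hx, Real.rpow_natCast]
  have hexp : Real.exp (-((r + 1) * x)) = Real.exp (-(r * x)) * Real.exp (-x) := by
    rw [← Real.exp_add]; ring_nf
  simp only [gammaPDFReal, if_pos hx.le, hpow, hexp]
  ring

theorem integral_pow_mul_exp_neg_gammaMeasure_pos {a r : ℝ} (ha : 0 < a) (hr : 0 < r) (n : ℕ) :
    0 < ∫ x, x ^ n * Real.exp (-x) ∂gammaMeasure a r := by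
  rw [integral_pow_mul_exp_neg_gammaMeasure ha hr]
  have := Real.Gamma_pos_of_pos ha
  have := Real.Gamma_pos_of_pos (show 0 < a + n by positivity)
  positivity

theorem integral_pow_succ_mul_exp_neg_gammaMeasure {a r : ℝ} (ha : 0 < a) (hr : 0 < r) (n : ℕ) :
    ∫ x, x ^ (n + 1) * Real.exp (-x) ∂gammaMeasure a r =
      (a + n) / (r + 1) * ∫ x, x ^ n * Real.exp (-x) ∂gammaMeasure a r := by
  rw [integral_pow_mul_exp_neg_gammaMeasure ha hr, integral_pow_mul_exp_neg_gammaMeasure ha hr]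
  push_cast
  rw [← add_assoc, Real.Gamma_add_one (by positivity), Real.rpow_add_one (by positivity)]
  ring

end Gamma

section ProductGamma

variable {a r : ι → ℝ}

theorem isProbabilityMeasure_pi_gammaMeasure (ha : ∀ i, 0 < a i) (hr : ∀ i, 0 < r i) :
    IsProbabilityMeasure (Measure.pi fun i => gammaMeasure (a i) (r i)) := by
  have := fun i => isProbabilityMeasure_gammaMeasure (ha i) (hr i)
  infer_instance

theorem ae_nonneg_pi_gammaMeasure (ha : ∀ i, 0 < a i) (hr : ∀ i, 0 < r i) :
    ∀ᵐ u ∂Measure.pi (fun i => gammaMeasure (a i) (r i)), 0 ≤ u := by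
  have := fun i => isProbabilityMeasure_gammaMeasure (ha i) (hr i)
  exact Measure.ae_le_pi fun i => ae_nonneg_gammaMeasure (a i) (r i)

theorem nonpos_of_ae_le_pi_gammaMeasure (ha : ∀ i, 0 < a i) (hr : ∀ i, 0 < r i) {l : ι → ℝ}
    (h : ∀ᵐ u ∂Measure.pi (fun i => gammaMeasure (a i) (r i)), l ≤ u) : l ≤ 0 := by
  have := fun i => isProbabilityMeasure_gammaMeasure (ha i) (hr i)
  refine fun i => nonpos_of_ae_le_gammaMeasure (ha i) (hr i) ?_
  rw [← (measurePreserving_eval (fun i => gammaMeasure (a i) (r i)) i).map_eq]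
  exact (ae_map_iff (measurable_pi_apply i).aemeasurable measurableSet_Ici).2
    (h.mono fun u hu => hu i)

theorem poissonMoment_pi_gammaMeasure (ha : ∀ i, 0 < a i) (hr : ∀ i, 0 < r i) (y : ι → ℕ) :
    poissonMoment (Measure.pi fun i => gammaMeasure (a i) (r i)) y =
      ∏ i, ∫ x, x ^ y i * Real.exp (-x) ∂gammaMeasure (a i) (r i) := by
  have := fun i => isProbabilityMeasure_gammaMeasure (ha i) (hr i)
  exact integral_fintype_prod_eq_prod (fun i x => x ^ y i * Real.exp (-x))

theorem poissonMoment_pi_gammaMeasure_add_single [DecidableEq ι] (ha : ∀ i, 0 < a i)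
    (hr : ∀ i, 0 < r i) (y : ι → ℕ) (i : ι) :
    poissonMoment (Measure.pi fun i => gammaMeasure (a i) (r i)) (y + Pi.single i 1) =
      (a i + y i) / (r i + 1) *
        poissonMoment (Measure.pi fun i => gammaMeasure (a i) (r i)) y := by
  rw [poissonMoment_pi_gammaMeasure ha hr, poissonMoment_pi_gammaMeasure ha hr,
    ← Finset.mul_prod_erase _ _ (Finset.mem_univ i),
    ← Finset.mul_prod_erase _ _ (Finset.mem_univ i), ← mul_assoc]
  congr 1
  · simpa using integral_pow_succ_mul_exp_neg_gammaMeasure (ha i) (hr i) (y i)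
  · exact Finset.prod_congr rfl fun j hj => by simp [Finset.ne_of_mem_erase hj]

variable [DecidableEq ι]

theorem affineRecursion_pi_gammaMeasure (ha : ∀ i, 0 < a i) (hr : ∀ i, 0 < r i) :
    AffineRecursion (poissonMoment (Measure.pi fun i => gammaMeasure (a i) (r i)))
      (diagonal fun i => 1 / (r i + 1)) (fun i => a i / (r i + 1)) where
  pos y := by
    rw [poissonMoment_pi_gammaMeasure ha hr]
    exact Finset.prod_pos fun i _ => integral_pow_mul_exp_neg_gammaMeasure_pos (ha i) (hr i) _
  step y i := by
    rw [poissonMoment_pi_gammaMeasure_add_single ha hr, affineCoeff, Pi.add_apply, mulVec_diagonal]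
    ring

variable {H : Matrix ι ι ℝ} {c : ι → ℝ}

theorem affineRecursion_pi_gammaMeasure_of_isDiag (hH : H.IsDiag)
    (hdiag : ∀ i, 0 < H i i ∧ H i i < 1) (hc : ∀ i, 0 < c i) :
    AffineRecursion (poissonMoment
      (Measure.pi fun i => gammaMeasure (c i / H i i) ((1 - H i i) / H i i))) H c := by
  have hrate : ∀ i, (1 - H i i) / H i i + 1 = 1 / H i i := fun i => by
    rw [div_add_one (hdiag i).1.ne', sub_add_cancel]
  have h := affineRecursion_pi_gammaMeasure (fun i => div_pos (hc i) (hdiag i).1)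
    (fun i => div_pos (sub_pos.2 (hdiag i).2) (hdiag i).1)
  have hoffset : (fun i => c i / H i i / (1 / H i i)) = c :=
    funext fun i => by rw [div_div_div_cancel_right₀ (hdiag i).1.ne', div_one]
  have hmatrix : (diagonal fun i => H i i) = H := hH.diagonal_diag
  simpa only [hrate, one_div_one_div, hoffset, hmatrix] using h

theorem AffineRecursion.eq_pi_gammaMeasure {P : Measure (ι → ℝ)} [IsProbabilityMeasure P]
    (hP : ∀ᵐ u ∂P, 0 ≤ u) (h : AffineRecursion (poissonMoment P) H c) (hH : H.IsDiag)
    (hdiag : ∀ i, 0 < H i i ∧ H i i < 1) :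
    P = Measure.pi fun i => gammaMeasure (c i / H i i) ((1 - H i i) / H i i) := by
  have hshape : ∀ i, 0 < c i / H i i := fun i => div_pos (h.offset_pos i) (hdiag i).1
  have hrate : ∀ i, 0 < (1 - H i i) / H i i := fun i =>
    div_pos (sub_pos.2 (hdiag i).2) (hdiag i).1
  have := isProbabilityMeasure_pi_gammaMeasure hshape hrate
  exact h.eq_of_poissonMoment hP (ae_nonneg_pi_gammaMeasure hshape hrate)
    (affineRecursion_pi_gammaMeasure_of_isDiag hH hdiag h.offset_pos)

end ProductGamma

section Channel

variable {k n : ℕ} {Ω : Type*} [MeasurableSpace Ω] {μ : Measure Ω}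
  {A : Matrix (Fin k) (Fin n) ℝ} {lam : Fin k → ℝ} {X : Ω → Fin n → ℝ} {Y : Ω → Fin k → ℕ}

/-- The law of the vector `A X + λ` of Poisson intensities. -/
noncomputable def intensityLaw (μ : Measure Ω) (A : Matrix (Fin k) (Fin n) ℝ) (lam : Fin k → ℝ)
    (X : Ω → Fin n → ℝ) : Measure (Fin k → ℝ) :=
  μ.map fun ω => A *ᵥ X ω + lam

theorem measurable_mulVec_add (A : Matrix (Fin k) (Fin n) ℝ) (lam : Fin k → ℝ) :
    Measurable fun x : Fin n → ℝ => A *ᵥ x + lam :=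
  Continuous.measurable (by fun_prop)

theorem measurable_intensity (hX : Measurable X) : Measurable fun ω => A *ᵥ X ω + lam :=
  (measurable_mulVec_add A lam).comp hX

theorem ae_le_intensityLaw (hX : Measurable X) (hAX : ∀ᵐ ω ∂μ, ∀ i, 0 ≤ (A *ᵥ X ω) i) :
    ∀ᵐ u ∂intensityLaw μ A lam X, lam ≤ u := by
  rw [intensityLaw, ae_map_iff (measurable_intensity hX).aemeasurable measurableSet_Ici]
  exact hAX.mono fun ω hω => le_add_of_nonneg_left hω

theorem channelPMF_eq_poissonWeight_div (A : Matrix (Fin k) (Fin n) ℝ) (lam : Fin k → ℝ)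
    (x : Fin n → ℝ) (y : Fin k → ℕ) :
    channelPMF A lam x y = poissonWeight y (A *ᵥ x + lam) / ∏ i, ((y i).factorial : ℝ) := by
  simp [channelPMF, poissonWeight, Finset.prod_div_distrib]

theorem hasCondMean_iff_setIntegral_eq_smul [IsFiniteMeasure μ] {m : ℕ} {Z : Ω → Fin m → ℝ}
    {y : Fin k → ℕ} {z : Fin m → ℝ} :
    HasCondMean μ Z Y y z ↔ 0 < μ.real (Y ⁻¹' {y}) ∧ IntegrableOn Z (Y ⁻¹' {y}) μ ∧
      ∫ ω in Y ⁻¹' {y}, Z ω ∂μ = μ.real (Y ⁻¹' {y}) • z := by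
  have hpos : 0 < μ (Y ⁻¹' {y}) ↔ 0 < μ.real (Y ⁻¹' {y}) := by
    simp [measureReal_def, ENNReal.toReal_pos_iff]
  rw [HasCondMean, hpos]
  refine and_congr_right fun h => and_congr_right fun _ => ?_
  rw [ProbabilityTheory.cond, integral_smul_measure, ENNReal.toReal_inv, ← measureReal_def,
    inv_smul_eq_iff₀ h.ne']

theorem HasCondMean.mulVec {m l : ℕ} {Z : Ω → Fin m → ℝ} {y : Fin k → ℕ} {z : Fin m → ℝ}
    (h : HasCondMean μ Z Y y z) (M : Matrix (Fin l) (Fin m) ℝ) :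
    HasCondMean μ (fun ω => M *ᵥ Z ω) Y y (M *ᵥ z) := by
  obtain ⟨hpos, hint, rfl⟩ := h
  let L : (Fin m → ℝ) →L[ℝ] (Fin l → ℝ) := LinearMap.toContinuousLinearMap M.mulVecLin
  exact ⟨hpos, L.integrable_comp hint,
    L.integral_comp_comm (hint.smul_measure (ENNReal.inv_ne_top.2 hpos.ne'))⟩

theorem HasCondMean.add_const [IsFiniteMeasure μ] {m : ℕ} {Z : Ω → Fin m → ℝ} {y : Fin k → ℕ}
    {z : Fin m → ℝ} (h : HasCondMean μ Z Y y z) (w : Fin m → ℝ) :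
    HasCondMean μ (fun ω => Z ω + w) Y y (z + w) := by
  rw [hasCondMean_iff_setIntegral_eq_smul] at h ⊢
  obtain ⟨hpos, hint, hmean⟩ := h
  refine ⟨hpos, hint.add (integrable_const w), ?_⟩
  rw [integral_add hint (integrable_const w), hmean, setIntegral_const, smul_add]

namespace IsPoissonOutput

theorem map_restrict_intensity (hX : Measurable X) (h : IsPoissonOutput μ A lam X Y)
    (y : Fin k → ℕ) :
    (μ.restrict (Y ⁻¹' {y})).map (fun ω => A *ᵥ X ω + lam) =
      (intensityLaw μ A lam X).withDensity
        fun u => ENNReal.ofReal (poissonWeight y u / ∏ i, ((y i).factorial : ℝ)) := by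
  have hf := measurable_mulVec_add A lam
  have hU : Measurable fun ω => A *ᵥ X ω + lam := measurable_intensity hX
  ext B hB
  rw [Measure.map_apply hU hB, Measure.restrict_apply (hU hB), withDensity_apply _ hB,
    intensityLaw, ← Function.comp_def (fun x => A *ᵥ x + lam) X, ← Measure.map_map hf hX,
    setLIntegral_map hB (by fun_prop) hf]
  simp only [← channelPMF_eq_poissonWeight_div]
  exact h _ (hf hB) y

section SetIntegral

variable {E : Type*} [NormedAddCommGroup E] [NormedSpace ℝ E] {g : (Fin k → ℝ) → E}

theorem integrableOn_comp_intensity_iff (hX : Measurable X) (h : IsPoissonOutput μ A lam X Y)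
    (hP : ∀ᵐ u ∂intensityLaw μ A lam X, 0 ≤ u) (y : Fin k → ℕ) (hg : StronglyMeasurable g) :
    IntegrableOn (fun ω => g (A *ᵥ X ω + lam)) (Y ⁻¹' {y}) μ ↔
      Integrable (fun u => poissonWeight y u • g u) (intensityLaw μ A lam X) := by
  have hfac : IsUnit (∏ i, ((y i).factorial : ℝ))⁻¹ := IsUnit.mk0 _ (by positivity)
  rw [IntegrableOn, ← Function.comp_def g, ← integrable_map_measure hg.aestronglyMeasurable
    (measurable_intensity hX).aemeasurable, h.map_restrict_intensity hX,
    integrable_withDensity_iff_integrable_smul' (by fun_prop) (by simp),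
    integrable_congr (hP.mono fun u hu => toReal_ofReal_poissonWeight_div_smul y hu (g u))]
  exact hfac.integrable_smul_iff _

theorem setIntegral_comp_intensity (hX : Measurable X) (h : IsPoissonOutput μ A lam X Y)
    (hP : ∀ᵐ u ∂intensityLaw μ A lam X, 0 ≤ u) (y : Fin k → ℕ) (hg : StronglyMeasurable g) :
    ∫ ω in Y ⁻¹' {y}, g (A *ᵥ X ω + lam) ∂μ =
      (∏ i, ((y i).factorial : ℝ))⁻¹ • ∫ u, poissonWeight y u • g u ∂intensityLaw μ A lam X := by
  rw [← integral_map (measurable_intensity hX).aemeasurable hg.aestronglyMeasurable,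
    h.map_restrict_intensity hX,
    integral_withDensity_eq_integral_toReal_smul (by fun_prop) (by simp),
    integral_congr_ae (hP.mono fun u hu => toReal_ofReal_poissonWeight_div_smul y hu (g u)),
    integral_smul]

end SetIntegral

theorem measureReal_preimage_singleton (hX : Measurable X) (h : IsPoissonOutput μ A lam X Y)
    (hP : ∀ᵐ u ∂intensityLaw μ A lam X, 0 ≤ u) (y : Fin k → ℕ) :
    μ.real (Y ⁻¹' {y}) =
      (∏ i, ((y i).factorial : ℝ))⁻¹ * poissonMoment (intensityLaw μ A lam X) y := by
  simpa [poissonMoment] using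
    h.setIntegral_comp_intensity hX hP y (g := fun _ => (1 : ℝ)) stronglyMeasurable_const

theorem hasCondMean_iff [IsFiniteMeasure μ] (hX : Measurable X) (h : IsPoissonOutput μ A lam X Y)
    (hP : ∀ᵐ u ∂intensityLaw μ A lam X, 0 ≤ u) (y : Fin k → ℕ) (z : Fin k → ℝ) :
    HasCondMean μ (fun ω => A *ᵥ X ω + lam) Y y z ↔
      0 < poissonMoment (intensityLaw μ A lam X) y ∧
        ∀ i, poissonMoment (intensityLaw μ A lam X) (y + Pi.single i 1) =
          z i * poissonMoment (intensityLaw μ A lam X) y := by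
  have : IsFiniteMeasure (intensityLaw μ A lam X) := Measure.isFiniteMeasure_map _ _
  have hfac : 0 < (∏ i, ((y i).factorial : ℝ))⁻¹ := by positivity
  have hint : IntegrableOn (fun ω => A *ᵥ X ω + lam) (Y ⁻¹' {y}) μ :=
    (h.integrableOn_comp_intensity_iff hX hP y stronglyMeasurable_id).2
      (integrable_poissonWeight_smul hP y)
  have hmean : ∫ ω in Y ⁻¹' {y}, A *ᵥ X ω + lam ∂μ = (∏ i, ((y i).factorial : ℝ))⁻¹ •
      ∫ u, poissonWeight y u • u ∂intensityLaw μ A lam X :=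
    h.setIntegral_comp_intensity hX hP y stronglyMeasurable_id
  rw [hasCondMean_iff_setIntegral_eq_smul, h.measureReal_preimage_singleton hX hP,
    mul_pos_iff_of_pos_left hfac, and_iff_right hint, hmean, mul_smul,
    smul_right_inj hfac.ne', funext_iff]
  simp only [integral_poissonWeight_smul_apply hP, Pi.smul_apply, smul_eq_mul, mul_comm]

theorem affineRecursion [IsFiniteMeasure μ] (hX : Measurable X) (hXY : IsPoissonOutput μ A lam X Y)
    (hP : ∀ᵐ u ∂intensityLaw μ A lam X, 0 ≤ u) {C : Matrix (Fin n) (Fin k) ℝ} {b : Fin n → ℝ}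
    (h : ∀ y, HasCondMean μ X Y y (C *ᵥ toReal y + b)) :
    AffineRecursion (poissonMoment (intensityLaw μ A lam X)) (A * C) (A *ᵥ b + lam) := by
  have hmoment := fun y => (hXY.hasCondMean_iff hX hP y _).1 (((h y).mulVec A).add_const lam)
  refine ⟨fun y => (hmoment y).1, fun y i => ?_⟩
  rw [(hmoment y).2 i, mulVec_add, mulVec_mulVec, add_assoc]
  rfl

end IsPoissonOutput

theorem Nondegenerate.eq_zero_of_vecMul_eq_zero [IsFiniteMeasure μ] (hX : Measurable X)
    (hU : Nondegenerate μ fun ω => A *ᵥ X ω + lam) (hP : ∀ᵐ u ∂intensityLaw μ A lam X, 0 ≤ u)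
    {H : Matrix (Fin k) (Fin k) ℝ} {c : Fin k → ℝ}
    (h : AffineRecursion (poissonMoment (intensityLaw μ A lam X)) H c) (v : Fin k → ℝ)
    (hv : v ᵥ* H = 0) : v = 0 := by
  have : IsFiniteMeasure (intensityLaw μ A lam X) := Measure.isFiniteMeasure_map _ _
  by_contra hne
  exact hU v hne
    ⟨v ⬝ᵥ c, ae_of_ae_map (measurable_intensity hX).aemeasurable (h.ae_dotProduct_eq hP hv)⟩

section Characterization

variable [IsProbabilityMeasure μ] {C : Matrix (Fin n) (Fin k) ℝ} {b : Fin n → ℝ}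

theorem productGammaConditions_of_hasCondMean (hlam : 0 ≤ lam) (hX : Measurable X)
    (hAX : ∀ᵐ ω ∂μ, ∀ i, 0 ≤ (A *ᵥ X ω) i) (hXY : IsPoissonOutput μ A lam X Y)
    (hU : Nondegenerate μ fun ω => A *ᵥ X ω + lam)
    (h : ∀ y, HasCondMean μ X Y y (C *ᵥ toReal y + b)) :
    ProductGammaConditions μ A lam X C b := by
  have : IsProbabilityMeasure (intensityLaw μ A lam X) :=
    Measure.isProbabilityMeasure_map (measurable_intensity hX).aemeasurable
  have hle : ∀ᵐ u ∂intensityLaw μ A lam X, lam ≤ u := ae_le_intensityLaw hX hAX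
  have hP : ∀ᵐ u ∂intensityLaw μ A lam X, 0 ≤ u := hle.mono fun _ => hlam.trans
  have hrec := hXY.affineRecursion hX hP h
  have hker := hU.eq_zero_of_vecMul_eq_zero hX hP hrec
  have hdiag : ∀ i, 0 < (A * C) i i ∧ (A * C) i i < 1 := fun i =>
    ⟨hrec.diag_pos hker i, hrec.diag_lt_one hP i⟩
  have hlaw := hrec.eq_pi_gammaMeasure hP (hrec.isDiag hker) hdiag
  have hlam_nonpos : lam ≤ 0 := nonpos_of_ae_le_pi_gammaMeasure
    (fun i => div_pos (hrec.offset_pos i) (hdiag i).1)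
    (fun i => div_pos (sub_pos.2 (hdiag i).2) (hdiag i).1) (hlaw ▸ hle)
  obtain rfl : lam = 0 := hlam_nonpos.antisymm hlam
  exact ⟨rfl, hrec.isDiag hker, hdiag, by simpa using hrec.offset_pos,
    by simpa [intensityLaw] using hlaw⟩

theorem ProductGammaConditions.hasCondMean (hX : Measurable X)
    (hAX : ∀ᵐ ω ∂μ, ∀ i, 0 ≤ (A *ᵥ X ω) i) (hXY : IsPoissonOutput μ A lam X Y)
    (h : ProductGammaConditions μ A lam X C b) (y : Fin k → ℕ) :
    HasCondMean μ (fun ω => A *ᵥ X ω) Y y (A *ᵥ (C *ᵥ toReal y + b)) := by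
  obtain ⟨rfl, hisDiag, hdiag, hpos, hlaw⟩ := h
  have hrec := affineRecursion_pi_gammaMeasure_of_isDiag hisDiag hdiag hpos
  have hintensity : intensityLaw μ A 0 X = μ.map fun ω => A *ᵥ X ω := by
    simp only [intensityLaw, add_zero]
  rw [← hlaw, ← hintensity] at hrec
  simpa only [add_zero] using (hXY.hasCondMean_iff hX (ae_le_intensityLaw hX hAX) y _).2
    ⟨hrec.pos y, fun i => by
      rw [hrec.step, mulVec_add, mulVec_mulVec]
      rfl⟩

end Characterization

theorem ProductGammaConditions.isUnit_det {A C : Matrix (Fin k) (Fin k) ℝ} {X : Ω → Fin k → ℝ}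
    {b : Fin k → ℝ} (h : ProductGammaConditions μ A lam X C b) : IsUnit A.det := by
  have hdet : (A * C).det ≠ 0 := by
    rw [← h.isDiag.diagonal_diag, det_diagonal]
    exact Finset.prod_ne_zero_iff.2 fun i _ => (h.diag_mem i).1.ne'
  rw [det_mul] at hdet
  exact isUnit_iff_ne_zero.2 (left_ne_zero_of_mul hdet)

end Channel

end PoissonChannel

theorem corollary1 {Ω : Type*} [MeasurableSpace Ω] (μ : Measure Ω) [IsProbabilityMeasure μ]
    {k n : ℕ} (A : Matrix (Fin k) (Fin n) ℝ) (lam : Fin k → ℝ) (hlam : ∀ i, 0 ≤ lam i)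
    (X : Ω → Fin n → ℝ) (hX : Measurable X) (Y : Ω → Fin k → ℕ) (hY : Measurable Y)
    (hAX : ∀ᵐ ω ∂μ, ∀ i, 0 ≤ (A *ᵥ X ω) i)
    (hXY : PoissonChannel.IsPoissonOutput μ A lam X Y)
    (hU : PoissonChannel.Nondegenerate μ (fun ω => A *ᵥ X ω + lam))
    (C : Matrix (Fin n) (Fin k) ℝ) (b : Fin n → ℝ) :
    (k = n →
      ((∀ y, PoissonChannel.HasCondMean μ X Y y (C *ᵥ PoissonChannel.toReal y + b)) ↔
        PoissonChannel.ProductGammaConditions μ A lam X C b)) ∧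
    ((∀ y, PoissonChannel.HasCondMean μ X Y y (C *ᵥ PoissonChannel.toReal y + b)) →
      PoissonChannel.ProductGammaConditions μ A lam X C b) ∧
    (PoissonChannel.ProductGammaConditions μ A lam X C b →
      ∀ y, PoissonChannel.HasCondMean μ (fun ω => A *ᵥ X ω) Y y
        (A *ᵥ (C *ᵥ PoissonChannel.toReal y + b))) := by
  have hfwd := PoissonChannel.productGammaConditions_of_hasCondMean (C := C) (b := b)
    hlam hX hAX hXY hU
  refine ⟨?_, hfwd, fun h => h.hasCondMean hX hAX hXY⟩
  rintro rfl
  refine ⟨hfwd, fun h y => ?_⟩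
  simpa [mulVec_mulVec, nonsing_inv_mul _ h.isUnit_det] using
    (h.hasCondMean hX hAX hXY y).mulVec A⁻¹
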